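/- Fix an integer $n \ge 1$. A finite structure of arity $n$ is a pair $(U,e)$ with $U$ a finite set and $e \subseteq U^n \times U^n$. For $\bar m, \bar o \in U^n$ read $e(\bar m,\bar o)$ as "the joint outcome $\bar o$ is possible for the joint measurement $\bar m$". Let $\mathsf{HV}(n)$ be the class of those $(U,e)$ such that 1. $e$ is total: for every $\bar m\in U^n$ there is $\bar o\in U^n$ with $e(\bar m,\bar o)$; and 2. $e$ is realizable by local hidden variables: there are a set $\Lambda$ and a relation $h \subseteq U^n\times U^n\times \Lambda$ such that (realization) for all $\bar m,\bar o$: $e(\bar m,\bar o)$ if and only if $h(\bar m,\bar o,\lambda)$ for some $\lambda\in\Lambda$; ($\lambda$-independence) for all $\bar m,\bar m'\in U^n$ and $\lambda\in\Lambda$: if $h(\bar m',\bar o',\lambda')$ holds for some $\bar o',\lambda'$, and $h(\bar m,\bar o,\lambda)$ holds for some $\bar o$, then $h(\bar m',\bar o'',\lambda)$ holds for some $\bar o''$; (locality) for all $\bar m,\bar o\in U^n$ and $\lambda\in\Lambda$: if $h(\bar m,\bar o',\lambda)$ holds for some $\bar o'$, and for every $i\in\{1,\dots,n\}$ there are $\bar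 m',\bar o'$ with $\bar m'_i=\bar m_i$, $\bar o'_i=\bar o_i$ and $h(\bar m',\bar o',\lambda)$, then $h(\bar m,\bar o,\lambda)$. Encode a finite structure $(U,e)$ with $k$ elements, listed in some order, by the bit string that consists of $1^k0$ followed by the $k^{2n}$ truth values of $e$ on $U^n\times U^n$ in lexicographic order. **Proposition.** For each $n\ge 1$, $\mathsf{HV}(n)$ is in $\mathsf{NP}$: the language of all encodings of structures in $\mathsf{HV}(n)$ belongs to $\mathsf{NP}$. -/

import Mathlib

namespace HiddenVariable

/-! ### Relational models -/

/-- A relational empirical model of type `(M, O)`, where `M = ∏ i, M i`, `O = ∏ i, O i`: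
a relation `e ⊆ M × O`. -/
def EmpiricalModel {n : ℕ} (M O : Fin n → Type) : Type :=
  (∀ i, M i) → (∀ i, O i) → Prop

/-- A relational hidden-variable model of type `(M, O)` with set `Λ` of values of the hidden
variable: a relation `h ⊆ M × O × Λ`. -/
def HVModel {n : ℕ} (M O : Fin n → Type) (Λ : Type) : Type :=
  (∀ i, M i) → (∀ i, O i) → Λ → Prop

section Properties

variable {n : ℕ} {M O : Fin n → Type} {Λ : Type}

/-- `e` is total: every combination of measurements has some possible outcome. -/
def EmpiricalModel.Total (e : EmpiricalModel M O) : Prop :=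
  ∀ m, ∃ o, e m o

/-- The hidden-variable model `h` realizes the empirical model `e`. -/
def HVModel.Realizes (h : HVModel M O Λ) (e : EmpiricalModel M O) : Prop :=
  ∀ m o, e m o ↔ ∃ l, h m o l

/-- `λ`-independence: `h(m')↓` and `h(m, λ)↓` imply `h(m', λ)↓`. -/
def HVModel.LambdaIndependent (h : HVModel M O Λ) : Prop :=
  ∀ m m' l, (∃ o' l', h m' o' l') → (∃ o, h m o l) → ∃ o', h m' o' l

/-- Locality: if `h(m, λ)↓`, and `h(mᵢ, oᵢ, λ)↓` for all `i`, then `h(m, o, λ)`. -/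
def HVModel.Local (h : HVModel M O Λ) : Prop :=
  ∀ m o l, (∃ o', h m o' l) →
    (∀ i, ∃ m' o', m' i = m i ∧ o' i = o i ∧ h m' o' l) → h m o l

/-- `e` is realized by a local hidden-variable model, that is, by a hidden-variable model
satisfying `λ`-independence and locality. -/
def EmpiricalModel.LocallyRealizable (e : EmpiricalModel M O) : Prop :=
  ∃ (Λ : Type) (h : HVModel M O Λ), h.Realizes e ∧ h.LambdaIndependent ∧ h.Local

end Properties

/-- A finite structure `(U, e)` of arity `n`, with `e ⊆ Uⁿ × Uⁿ`: a relational model with the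
same finite set `U` of measurements and of outcomes at each of the `n` sites. -/
structure FinModel (n : ℕ) where
  U : Type
  finite : Finite U
  e : EmpiricalModel (fun _ : Fin n => U) (fun _ : Fin n => U)

/-- The class `HV(n)` of structures `(U, e)` of arity `n` that are total and realizable by
local hidden variables. -/
def HV (n : ℕ) : Set (FinModel n) :=
  {A | A.e.Total ∧ A.e.LocallyRealizable}

/-! ### Finite structures as bit strings -/

/-- All `n`-tuples of elements of `{0, …, k - 1}`, in lexicographic order. -/
def tuples (k : ℕ) : (n : ℕ) → List (Fin n → Fin k)
  | 0 => [Fin.elim0]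
  | n + 1 => (List.finRange k).flatMap fun a =>
      (tuples k n).map fun t => (Fin.cons a t : Fin (n + 1) → Fin k)

open Classical in
/-- The standard encoding of a finite structure whose universe is listed as
`σ 0, …, σ (k - 1)`: the size `k` in unary, written `1ᵏ0`, followed by the `k ^ (2 * n)` truth
values of the relation on all pairs of `n`-tuples, in lexicographic order. -/
noncomputable def FinModel.encode {n k : ℕ} (A : FinModel n) (σ : Fin k ≃ A.U) : List Bool :=
  List.replicate k true ++ false :: (tuples k n).flatMap fun x =>
    (tuples k n).map fun y => decide (A.e (fun i => σ (x i)) (fun i => σ (y i)))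

/-- The language of all encodings, for all listings of the universe, of the structures in a
class `C`. -/
def languageOf {n : ℕ} (C : Set (FinModel n)) : Language Bool :=
  {w | ∃ A ∈ C, ∃ (k : ℕ) (σ : Fin k ≃ A.U), A.encode σ = w}

/-! ### The complexity class NP -/

/-- The input `x#w` of a verifier, with `none` as the separator `#`. -/
def encodePair (xw : List Bool × List Bool) : List (Option Bool) :=
  xw.1.map some ++ none :: xw.2.map some

/-- `L` is in NP: there are a polynomial `p` and a predicate `V` on pairs of strings, decided by
a Turing machine in time polynomial in the length of its input, such that `x ∈ L` if and
only if `V` accepts `x` together with some certificate `w` of length at most `p |x|`. -/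
def InNP (L : Language Bool) : Prop :=
  ∃ (p : Polynomial ℕ) (V : List Bool × List Bool → Bool)
    (T : Turing.TM2ComputableInPolyTime encodePair Computability.encodeBool V),
    (∀ j, Finite (T.tm.Γ j)) ∧
    ∀ x, x ∈ L ↔ ∃ w, w.length ≤ p.eval x.length ∧ V (x, w) = true

end HiddenVariable

/-! The hidden variable can be made small. Suppose `h` is a local hidden-variable model of `e`. For
each pair (m, o) in `e` pick one value λ with h(m, o, λ), and discard all other values. Every
possible pair keeps a value, so the model still realizes `e`. λ-independence and locality each
concern one value λ at a time, apart from the premise h(m')↓, which depends only on `e`; so both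
survive the restriction. Hence pairs of tuples suffice as values
(`EmpiricalModel.LocallyRealizable.exists_pairs`), and the model is a table of k^(4n) bits. As the
encoding of a structure has more than k^(2n) bits, this table is a certificate of at most quadratic
length (`mem_languageOf_HV_iff`).

For fixed n, checking a certificate means evaluating one fixed formula, whose quantifiers range over
numbers below k and whose atoms look up bits at positions polynomial in k. That this takes
polynomial time on a Turing machine is shown in two layers. Structured stack programs are compiled
into machines that simulate them step for step (`StackProg.Runs.steps`). The functions `Comp` that
such programs compute with unary counters are closed under sums, truncated subtraction, look-up in
the input and bounded summation. The last turns bounded quantifiers into sums of indicators, so the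
predicates `Dec` contain the verifier's condition (`dec_accepts`). -/

namespace HiddenVariable

/-! ### Structured stack programs -/

/-- Input symbols of a verifier: a bit, or the separator. -/
abbrev Sym : Type := Option Bool

/-- Structured programs over stacks of symbols, numbered by natural numbers. The tests of
`ite` and `loop` look at the top of a stack. -/
inductive StackProg : Type
  | skip
  | push (k : ℕ) (a : Sym)
  | pop (k : ℕ)
  | move (k l : ℕ)
  | seq (p q : StackProg)
  | ite (k : ℕ) (c : Option Sym → Bool) (p q : StackProg)
  | loop (k : ℕ) (c : Option Sym → Bool) (p : StackProg)

namespace StackProg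

open Function Turing

/-- `Runs p S S' t`: started on the stacks `S`, the program `p` ends with the stacks `S'` after
`t` steps. -/
inductive Runs : StackProg → (ℕ → List Sym) → (ℕ → List Sym) → ℕ → Prop
  | skip (S) : Runs skip S S 1
  | push (k a S) : Runs (push k a) S (update S k (a :: S k)) 1
  | pop (k S) : Runs (pop k) S (update S k (S k).tail) 1
  | move_nil (k l S) (h : S k = []) : Runs (move k l) S S 1
  | move_cons (k l a r S) (h : S k = a :: r) :
      Runs (move k l) S (update (update S k r) l (a :: update S k r l)) 1
  | seq {p q S S' S'' t u} (hp : Runs p S S' t) (hq : Runs q S' S'' u) :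
      Runs (seq p q) S S'' (t + u + 1)
  | ite_true {k c p q S S' t} (hc : c (S k).head? = true) (hp : Runs p S S' t) :
      Runs (ite k c p q) S S' (t + 1)
  | ite_false {k c p q S S' t} (hc : c (S k).head? = false) (hq : Runs q S S' t) :
      Runs (ite k c p q) S S' (t + 1)
  | loop_done {k c p S} (hc : c (S k).head? = false) : Runs (loop k c p) S S 1
  | loop_step {k c p S S' S'' t u} (hc : c (S k).head? = true) (hp : Runs p S S' t)
      (hl : Runs (loop k c p) S' S'' u) : Runs (loop k c p) S S'' (t + u + 1)

/-- A loop that runs through the states `S 0, …, S n`. -/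
theorem Runs.loop_family {k : ℕ} {c : Option Sym → Bool} {p : StackProg}
    {T : ℕ} : ∀ {n : ℕ} (S : ℕ → ℕ → List Sym),
    (∀ j < n, c (S j k).head? = true) → c (S n k).head? = false →
    (∀ j < n, ∃ t ≤ T, Runs p (S j) (S (j + 1)) t) →
    ∃ t ≤ n * (T + 1) + 1, Runs (loop k c p) (S 0) (S n) t
  | 0, S, _, hn, _ => ⟨1, by omega, .loop_done hn⟩
  | n + 1, S, hc, hn, hp => by
    obtain ⟨u, hu, hr⟩ := Runs.loop_family (n := n) (fun j => S (j + 1))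
      (fun j hj => hc _ (by omega)) hn (fun j hj => hp _ (by omega))
    obtain ⟨t, ht, hq⟩ := hp 0 (by omega)
    refine ⟨t + u + 1, ?_, .loop_step (hc 0 (by omega)) hq hr⟩
    rw [Nat.add_one_mul]
    omega

/-! ### Compilation to a Turing machine -/

/-- A bound for the stacks a program uses. -/
def bound : StackProg → ℕ
  | skip => 0
  | push k _ => k + 1
  | pop k => k + 1
  | move k l => max (k + 1) (l + 1)
  | seq p q => max p.bound q.bound
  | ite k _ p q => max (k + 1) (max p.bound q.bound)
  | loop k _ p => max (k + 1) p.bound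

/-- The continuations that occur while `p` is run and `r` remains to be run. -/
def conts : StackProg → List StackProg → Set (List StackProg)
  | seq p q, r => {seq p q :: r} ∪ (conts p (q :: r) ∪ conts q r)
  | ite k c p q, r => {ite k c p q :: r} ∪ (conts p r ∪ conts q r)
  | loop k c p, r => {loop k c p :: r} ∪ conts p (loop k c p :: r)
  | p, r => {p :: r}

/-- This makes the set of machine labels finite. A loop puts itself back on the same remainder `r`,
so iterating it creates no new continuations. -/
theorem conts_finite (p : StackProg) (r : List StackProg) : (conts p r).Finite := by
  induction p generalizing r with
  | seq p q hp hq => exact (Set.finite_singleton _).union ((hp _).union (hq _))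
  | ite k c p q hp hq => exact (Set.finite_singleton _).union ((hp _).union (hq _))
  | loop k c p hp => exact (Set.finite_singleton _).union (hp _)
  | _ => exact Set.finite_singleton _

theorem cons_mem_conts (p : StackProg) (r : List StackProg) : p :: r ∈ conts p r := by
  cases p <;> simp [conts]

/-- Labels of the machine for `P`: the continuations of `P`, and the empty one. -/
abbrev Label (P : StackProg) : Type := ↥(insert [] (conts P []))

/-- Stack alphabets of the machine: the output stack `none` holds bits. -/
abbrev Alphabet (N : ℕ) : Option (Fin N) → Type
  | none => Bool
  | some _ => Sym

section Compile

variable (P : StackProg) (N : ℕ) [NeZero N]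

open Classical in
/-- The label of a continuation. -/
noncomputable def label (l : List StackProg) : Label P :=
  if h : l ∈ insert [] (conts P []) then ⟨l, h⟩ else ⟨[], Set.mem_insert _ _⟩

/-- The machine statement that jumps to a continuation. -/
noncomputable def jump (l : List StackProg) : TM2.Stmt (Alphabet N) (Label P) (Option Sym) :=
  .load (fun _ => none) (.goto fun _ => label P l)

/-- The machine statement for a continuation. After the program has run, the machine replaces
the content of stack `2`, at most one symbol, by one bit on the output stack. -/
noncomputable def code : List StackProg → TM2.Stmt (Alphabet N) (Label P) (Option Sym)
  | [] => .pop (some (Fin.ofNat N 2)) (fun _ a => a) <|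
      .push none (fun v => v.isSome) <| .load (fun _ => none) .halt
  | skip :: r => jump P N r
  | push k a :: r => .push (some (Fin.ofNat N k)) (fun _ => a) (jump P N r)
  | pop k :: r => .pop (some (Fin.ofNat N k)) (fun v _ => v) (jump P N r)
  | move k l :: r => .pop (some (Fin.ofNat N k)) (fun _ a => a) <|
      .branch Option.isSome
        (.push (some (Fin.ofNat N l)) (fun v => v.getD none) (jump P N r)) (jump P N r)
  | seq p q :: r => jump P N (p :: q :: r)
  | ite k c p q :: r => .peek (some (Fin.ofNat N k)) (fun _ a => a) <|
      .branch c (jump P N (p :: r)) (jump P N (q :: r))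
  | loop k c p :: r => .peek (some (Fin.ofNat N k)) (fun _ a => a) <|
      .branch c (jump P N (p :: loop k c p :: r)) (jump P N r)

/-- The Turing machine that runs the program `P` with `N` stacks. -/
noncomputable def machine : FinTM2 where
  K := Option (Fin N)
  k₀ := some (Fin.ofNat N 0)
  k₁ := none
  Γ := Alphabet N
  Λ := Label P
  main := label P [P]
  ΛFin := ((conts_finite P []).insert []).fintype
  σ := Option Sym
  initialState := none
  Γk₀Fin := inferInstanceAs (Fintype (Option Bool))
  m := fun l => code P N l.1

/-- The stacks of the machine. -/
def stackFam (S : ℕ → List Sym) : ∀ j, List (Alphabet N j)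
  | none => []
  | some j => S j

variable {P N}

/-- The bound on `k` matters because `Fin.ofNat` reduces modulo `N`: without it, different stacks of
the program could share one stack of the machine. -/
theorem update_stackFam (S : ℕ → List Sym) {k : ℕ} (hk : k < N) (l : List Sym) :
    update (stackFam N S) (some (Fin.ofNat N k)) l = stackFam N (update S k l) := by
  funext j
  cases j with
  | none => rfl
  | some j =>
    by_cases h : j = Fin.ofNat N k
    · subst h
      simp [stackFam, Nat.mod_eq_of_lt hk]
    · have h' : (j : ℕ) ≠ k := fun e => h (by ext; simp [e, Nat.mod_eq_of_lt hk])
      rw [update_of_ne (fun e => h (Option.some.inj e))]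
      simp [stackFam, h']

theorem stackFam_apply (S : ℕ → List Sym) {k : ℕ} (hk : k < N) :
    stackFam N S (some (Fin.ofNat N k)) = S k := by
  simp [stackFam, Nat.mod_eq_of_lt hk]

/-- The configuration of the machine with continuation `l` and stacks `S`. -/
noncomputable def config (l : List StackProg) (S : ℕ → List Sym) : (machine P N).Cfg :=
  ⟨some (label P l), none, stackFam N S⟩

/-- The machine goes from configuration `a` to configuration `b` in `t` steps. -/
def Steps (M : FinTM2) (a b : M.Cfg) (t : ℕ) : Prop :=
  (flip bind M.step)^[t] (some a) = some b

theorem Steps.trans {M : FinTM2} {a b c : M.Cfg} {t u : ℕ} (h : Steps M a b t)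
    (h' : Steps M b c u) : Steps M a c (t + u) := by
  unfold Steps at *
  rw [add_comm, iterate_add_apply, h, h']

theorem steps_one {M : FinTM2} {a b : M.Cfg} (h : M.step a = some b) : Steps M a b 1 := h

theorem step_config {l : List StackProg} (hl : l ∈ insert [] (conts P []))
    (S : ℕ → List Sym) : (machine P N).step (config l S) =
      some (TM2.stepAux (code P N l) none (stackFam N S)) := by
  have : label P l = ⟨l, hl⟩ := dif_pos hl
  simp only [config, this]
  rfl

/-- Each rule of `Runs` costs exactly one machine step, so the times agree exactly. The inclusion
`hr` keeps every continuation met on the way among the labels, so that `label` never takes its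
default value. -/
theorem Runs.steps {p : StackProg} {S S' : ℕ → List Sym} {t : ℕ} (h : Runs p S S' t)
    (hN : p.bound ≤ N) {r : List StackProg}
    (hr : insert r (conts p r) ⊆ insert [] (conts P [])) :
    Steps (machine P N) (config (p :: r) S) (config r S') t := by
  induction h generalizing r with
  | skip S =>
    refine steps_one ?_
    rw [step_config (hr (.inr (cons_mem_conts _ _)))]
    rfl
  | push k a S =>
    refine steps_one ?_
    rw [step_config (hr (.inr (cons_mem_conts _ _)))]
    rw [code, TM2.stepAux, update_stackFam _ hN, stackFam_apply _ hN]
    rfl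
  | pop k S =>
    refine steps_one ?_
    rw [step_config (hr (.inr (cons_mem_conts _ _)))]
    rw [code, TM2.stepAux, update_stackFam _ hN, stackFam_apply _ hN]
    rfl
  | move_nil k l S h =>
    have hk : k < N := (le_max_left _ _).trans hN
    refine steps_one ?_
    rw [step_config (hr (.inr (cons_mem_conts _ _)))]
    rw [code, TM2.stepAux, update_stackFam _ hk, stackFam_apply _ hk, h]
    have : update S k [] = S := by rw [← h, update_eq_self]
    simp only [List.tail, this]
    rfl
  | move_cons k l a r' S h =>
    have hk : k < N := (le_max_left _ _).trans hN
    have hl : l < N := (le_max_right _ _).trans hN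
    refine steps_one ?_
    rw [step_config (hr (.inr (cons_mem_conts _ _)))]
    rw [code, TM2.stepAux, update_stackFam _ hk, stackFam_apply _ hk, h, TM2.stepAux]
    simp only [List.head?_cons, Option.isSome_some, cond_true]
    rw [TM2.stepAux, update_stackFam _ hl, stackFam_apply _ hl]
    rfl
  | @seq p q S S' S'' t u hp hq ihp ihq =>
    have hqr : q :: r ∈ conts q r := cons_mem_conts _ _
    rw [add_comm]
    refine (steps_one ?_).trans ((ihp ((le_max_left _ _).trans hN) ?_).trans
      (ihq ((le_max_right _ _).trans hN) ?_))
    · rw [step_config (hr (.inr (cons_mem_conts _ _)))]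
      rfl
    · refine Set.Subset.trans ?_ hr
      exact Set.insert_subset (.inr (.inr (.inr hqr))) fun x hx => .inr (.inr (.inl hx))
    · refine Set.Subset.trans ?_ hr
      exact Set.insert_subset (.inl rfl) fun x hx => .inr (.inr (.inr hx))
  | @ite_true k c p q S S' t hc hp ih =>
    have hk : k < N := (le_max_left _ _).trans hN
    rw [add_comm]
    refine (steps_one ?_).trans (ih (((le_max_left _ _).trans (le_max_right _ _)).trans hN) ?_)
    · rw [step_config (hr (.inr (cons_mem_conts _ _)))]
      rw [code, TM2.stepAux, stackFam_apply _ hk, TM2.stepAux, hc]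
      rfl
    · refine Set.Subset.trans ?_ hr
      exact Set.insert_subset (.inl rfl) fun x hx => .inr (.inr (.inl hx))
  | @ite_false k c p q S S' t hc hp ih =>
    have hk : k < N := (le_max_left _ _).trans hN
    rw [add_comm]
    refine (steps_one ?_).trans (ih (((le_max_right _ _).trans (le_max_right _ _)).trans hN) ?_)
    · rw [step_config (hr (.inr (cons_mem_conts _ _)))]
      rw [code, TM2.stepAux, stackFam_apply _ hk, TM2.stepAux, hc]
      rfl
    · refine Set.Subset.trans ?_ hr
      exact Set.insert_subset (.inl rfl) fun x hx => .inr (.inr (.inr hx))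
  | @loop_done k c p S hc =>
    have hk : k < N := (le_max_left _ _).trans hN
    refine steps_one ?_
    rw [step_config (hr (.inr (cons_mem_conts _ _)))]
    rw [code, TM2.stepAux, stackFam_apply _ hk, TM2.stepAux, hc]
    rfl
  | @loop_step k c p S S' S'' t u hc hp hl ihp ihl =>
    have hk : k < N := (le_max_left _ _).trans hN
    rw [add_comm]
    refine (steps_one ?_).trans ((ihp ((le_max_right _ _).trans hN) ?_).trans (ihl hN hr))
    · rw [step_config (hr (.inr (cons_mem_conts _ _)))]
      rw [code, TM2.stepAux, stackFam_apply _ hk, TM2.stepAux, hc]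
      rfl
    · refine Set.Subset.trans ?_ hr
      exact Set.insert_subset (.inr (cons_mem_conts _ _)) fun x hx => .inr (.inr hx)

end Compile

/-- A function to `Bool` that a program computes in polynomial time, leaving its value on
stack `2` and all other stacks empty, is computed by a Turing machine in polynomial time. -/
theorem exists_polyTime {α : Type} (ea : α → List Sym) (f : α → Bool) (P : StackProg)
    (T : Polynomial ℕ)
    (h : ∀ a, ∃ t ≤ T.eval (ea a).length,
      Runs P (update (fun _ => []) 0 (ea a))
        (update (fun _ => []) 2 (if f a then [none] else [])) t) :
    ∃ M : TM2ComputableInPolyTime ea Computability.encodeBool f,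
      ∀ j, Finite (M.tm.Γ j) := by
  -- The extra 3 guarantees that stacks 0 (input) and 2 (result) exist and are distinct modulo `N`.
  let N := P.bound + 3
  have main : ∀ a, ∃ t ≤ (T + 1).eval (ea a).length,
      Steps (machine P N) (initList (machine P N) (ea a))
        (haltList (machine P N) [f a]) t := by
    intro a
    obtain ⟨t, ht, hr⟩ := h a
    refine ⟨t + 1, by simpa using ht, ?_⟩
    have e0 : initList (machine P N) (ea a) =
        config [P] (update (fun _ => []) 0 (ea a)) := by
      simp only [initList, config]
      congr 1
      funext j
      cases j with
      | none => rfl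
      | some j =>
        by_cases hj : j = Fin.ofNat N 0
        · subst hj
          rfl
        · refine (dif_neg (fun e => hj (Option.some.inj e))).trans ?_
          have : (j : ℕ) ≠ 0 := fun e => hj (Fin.ext (by simp [e]))
          exact (update_of_ne this (ea a) fun _ => []).symm
    rw [e0]
    refine (hr.steps (by omega) (Set.Subset.refl _)).trans (steps_one ?_)
    rw [step_config (Set.mem_insert _ _), code, TM2.stepAux,
      update_stackFam _ (show 2 < N by omega), stackFam_apply _ (show 2 < N by omega)]
    -- Popping the result leaves every working stack empty, as a halting configuration with only the
    -- output on its stacks requires.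
    have e1 : update (update (fun _ : ℕ => ([] : List Sym)) 2 (if f a then [none] else [])) 2
        (update (fun _ : ℕ => ([] : List Sym)) 2 (if f a then [none] else []) 2).tail =
          fun _ => [] := by
      funext j
      by_cases hj : j = 2
      · subst hj
        cases f a <;> simp
      · simp [hj]
    rw [e1]
    simp only [update_self, TM2.stepAux, haltList]
    congr 2
    funext j
    cases j with
    | none => cases f a <;> simp [machine] <;> rfl
    | some j => rfl
  choose t ht hs using main
  refine ⟨{ tm := machine P N
            inputAlphabet := Equiv.refl _
            outputAlphabet := Equiv.refl _
            time := T + 1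
            outputsFun := fun a =>
              { steps := t a
                evals_in_steps := ?_
                steps_le_m := ht a } }, ?_⟩
  · have e : (ea a).map (Equiv.refl ((machine P N).Γ (machine P N).k₀)).invFun = ea a :=
      List.map_id _
    have := hs a
    unfold Steps at this
    rw [← e] at this
    exact this
  · rintro (_ | j)
    · exact inferInstanceAs (Finite Bool)
    · exact inferInstanceAs (Finite (Option Bool))

end StackProg

end HiddenVariable

namespace HiddenVariable

/-! ### Functions computed in polynomial time with unary counters -/

open Function StackProg

namespace StackProg

/-- `RunsIn p S S' T`: started on the stacks `S`, the program `p` ends with the stacks `S'` after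
at most `T` steps. -/
def RunsIn (p : StackProg) (S S' : ℕ → List Sym) (T : ℕ) : Prop :=
  ∃ t ≤ T, Runs p S S' t

theorem Runs.runsIn {p : StackProg} {S S' : ℕ → List Sym} {t : ℕ} (h : Runs p S S' t) :
    RunsIn p S S' t := ⟨t, le_rfl, h⟩

theorem RunsIn.mono {p : StackProg} {S S' : ℕ → List Sym} {T U : ℕ} (h : RunsIn p S S' T)
    (hU : T ≤ U) : RunsIn p S S' U :=
  let ⟨t, ht, hr⟩ := h
  ⟨t, ht.trans hU, hr⟩

theorem RunsIn.seq {p q : StackProg} {S S' S'' : ℕ → List Sym} {T U : ℕ} (h : RunsIn p S S' T)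
    (h' : RunsIn q S' S'' U) : RunsIn (.seq p q) S S'' (T + U + 1) :=
  let ⟨t, ht, hr⟩ := h
  let ⟨u, hu, hq⟩ := h'
  ⟨t + u + 1, by omega, hr.seq hq⟩

/-- The stacks that represent a tape, split at the head into `r` and the reverse of `l`, and
counters `c`. -/
def tape (r l : List Sym) (c : ℕ → ℕ) : ℕ → List Sym
  | 0 => r
  | 1 => l
  | i + 2 => List.replicate (c i) none

variable {r l : List Sym} {c : ℕ → ℕ}

theorem update_tape_zero (r' : List Sym) : update (tape r l c) 0 r' = tape r' l c := by
  funext j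
  match j with
  | 0 => simp [tape]
  | 1 => simp [tape]
  | j + 2 => simp [tape]

theorem update_tape_one (l' : List Sym) : update (tape r l c) 1 l' = tape r l' c := by
  funext j
  match j with
  | 0 => simp [tape]
  | 1 => simp [tape]
  | j + 2 => simp [tape]

theorem update_tape_counter (i m : ℕ) :
    update (tape r l c) (i + 2) (List.replicate m none) = tape r l (update c i m) := by
  funext j
  match j with
  | 0 => simp [tape]
  | 1 => simp [tape]
  | j + 2 =>
    by_cases h : j = i
    · subst h
      simp [tape]
    · simp [tape, h]

theorem isSome_head?_tape (i : ℕ) : (tape r l c (i + 2)).head?.isSome = true ↔ c i ≠ 0 := by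
  cases h : c i <;> simp [tape, h, List.replicate_succ]

theorem not_isSome_head?_tape {i : ℕ} (h : c i = 0) :
    (tape r l c (i + 2)).head?.isSome = false := by
  simp [tape, h]

theorem runsIn_inc (i : ℕ) :
    RunsIn (push (i + 2) none) (tape r l c) (tape r l (update c i (c i + 1))) 1 := by
  rw [← update_tape_counter]
  exact (Runs.push _ _ _).runsIn

theorem runsIn_dec (i : ℕ) :
    RunsIn (pop (i + 2)) (tape r l c) (tape r l (update c i (c i - 1))) 1 := by
  rw [← update_tape_counter]
  have := (Runs.pop (i + 2) (tape r l c)).runsIn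
  rwa [show (tape r l c (i + 2)).tail = List.replicate (c i - 1) none from
    List.tail_replicate ..] at this

theorem runsIn_moveCounter {i j m : ℕ} (hij : i ≠ j) (h : c i = m + 1) :
    RunsIn (move (i + 2) (j + 2)) (tape r l c)
      (tape r l (update (update c i m) j (c j + 1))) 1 := by
  have := (Runs.move_cons (i + 2) (j + 2) none (List.replicate m none) (tape r l c)
    (by simp [tape, h, List.replicate_succ])).runsIn
  rw [update_tape_counter] at this
  rwa [show none :: tape r l (update c i m) (j + 2) = List.replicate (c j + 1) none by
    simp [tape, hij.symm, List.replicate_succ], update_tape_counter] at this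

theorem runsIn_right (a : Sym) :
    RunsIn (move 0 1) (tape (a :: r) l c) (tape r (a :: l) c) 1 := by
  have := (Runs.move_cons 0 1 a r (tape (a :: r) l c) rfl).runsIn
  rw [update_tape_zero] at this
  rwa [update_tape_one] at this

theorem runsIn_right_nil : RunsIn (move 0 1) (tape [] l c) (tape [] l c) 1 :=
  (Runs.move_nil 0 1 (tape [] l c) rfl).runsIn

theorem runsIn_left (a : Sym) :
    RunsIn (move 1 0) (tape r (a :: l) c) (tape (a :: r) l c) 1 := by
  have := (Runs.move_cons 1 0 a l (tape r (a :: l) c) rfl).runsIn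
  rw [update_tape_one] at this
  rwa [update_tape_zero] at this

/-- Empty counter `i`. -/
def clear (i : ℕ) : StackProg := loop (i + 2) Option.isSome (pop (i + 2))

theorem runsIn_clear (i : ℕ) :
    RunsIn (clear i) (tape r l c) (tape r l (update c i 0)) (c i * 2 + 1) := by
  have := Runs.loop_family (k := i + 2) (c := Option.isSome) (p := pop (i + 2)) (T := 1)
    (n := c i) (fun j => tape r l (update c i (c i - j)))
    (fun j hj => by rw [isSome_head?_tape, update_self]; omega)
    (not_isSome_head?_tape (by simp))
    (fun j hj => by
      have := runsIn_dec (r := r) (l := l) (c := update c i (c i - j)) i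
      rwa [update_idem, update_self, Nat.sub_sub] at this)
  rwa [Nat.sub_zero, update_eq_self, Nat.sub_self] at this

/-- Add counter `i` to counter `j`, and empty it. -/
def transfer (i j : ℕ) : StackProg := loop (i + 2) Option.isSome (move (i + 2) (j + 2))

theorem runsIn_transfer {i j : ℕ} (hij : i ≠ j) :
    RunsIn (transfer i j) (tape r l c)
      (tape r l (update (update c i 0) j (c j + c i))) (c i * 2 + 1) := by
  have := Runs.loop_family (k := i + 2) (c := Option.isSome) (p := move (i + 2) (j + 2)) (T := 1)
    (n := c i) (fun m => tape r l (update (update c i (c i - m)) j (c j + m)))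
    (fun m hm => by rw [isSome_head?_tape, update_of_ne hij, update_self]; omega)
    (not_isSome_head?_tape (by simp [hij]))
    (fun m hm => by
      have := runsIn_moveCounter (r := r) (l := l) (m := c i - (m + 1))
        (c := update (update c i (c i - m)) j (c j + m)) hij
        (by rw [update_of_ne hij, update_self]; omega)
      rwa [update_self, update_comm hij.symm, update_idem, update_idem, Nat.add_assoc] at this)
  rwa [Nat.sub_zero, update_eq_self, Nat.add_zero (c j), update_eq_self, Nat.sub_self] at this

/-- Move the head to the left end of the tape. -/
def rewind : StackProg := loop 1 Option.isSome (move 1 0)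

theorem runsIn_rewind :
    RunsIn rewind (tape r l c) (tape (l.reverse ++ r) [] c) (l.length * 2 + 1) := by
  induction l generalizing r with
  | nil => exact ⟨1, by simp, .loop_done rfl⟩
  | cons a l ih =>
    obtain ⟨u, hu, hr⟩ := ih (r := a :: r)
    obtain ⟨t, ht, hm⟩ := runsIn_left (r := r) (l := l) (c := c) a
    refine ⟨t + u + 1, by simp; omega, ?_⟩
    rw [List.reverse_cons, List.append_assoc]
    exact .loop_step rfl hm hr

end StackProg

variable {ι : Type}

/-- A function of a string and of numbers `x i` is feasible if a program computes it in time
polynomial in the length of the string and the numbers, when these are given in unary, and its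
value is polynomially bounded. The argument `x i` is in counter `loc i`, the value is left in
counter `v`, and the counters beyond `v` are scratch space. -/
def Comp (f : List Sym → (ι → ℕ) → ℕ) : Prop :=
  (∃ B : Polynomial ℕ, ∀ s x N, s.length ≤ N → (∀ i, x i ≤ N) → f s x ≤ B.eval N) ∧
  ∀ (loc : ι → ℕ) (v : ℕ), (∀ i, loc i < v) → ∃ (p : StackProg) (T : Polynomial ℕ),
    ∀ (s : List Sym) (c : ℕ → ℕ) (N : ℕ), s.length ≤ N → (∀ i, c i ≤ N) → (∀ i, v ≤ i → c i = 0) →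
      RunsIn p (tape s [] c) (tape s [] (update c v (f s fun i => c (loc i)))) (T.eval N)

/-! ### Closure properties of feasible functions -/

namespace Comp

variable {f g : List Sym → (ι → ℕ) → ℕ}

theorem reindex {κ : Type} {f : List Sym → (κ → ℕ) → ℕ} (hf : Comp f) (ρ : κ → ι) :
    Comp (fun s (x : ι → ℕ) => f s fun k => x (ρ k)) :=
  ⟨hf.1.imp fun _ hB s _ N hs hx => hB s _ N hs fun _ => hx _,
    fun loc v hv => hf.2 (fun k => loc (ρ k)) v fun _ => hv _⟩

theorem const (m : ℕ) : Comp (fun _ (_ : ι → ℕ) => m) := by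
  refine ⟨⟨Polynomial.C m, fun s x N _ _ => by simp⟩, fun loc v hv => ?_⟩
  induction m with
  | zero =>
    refine ⟨skip, 1, fun s c N _ _ h0 => ?_⟩
    rw [← h0 v le_rfl, update_eq_self, Polynomial.eval_one]
    exact (Runs.skip _).runsIn
  | succ m ih =>
    obtain ⟨p, T, h⟩ := ih
    refine ⟨seq p (push (v + 2) none), T + 1 + 1, fun s c N hs hc h0 => ?_⟩
    have h1 := runsIn_inc (r := s) (l := []) (c := update c v m) v
    rw [update_idem, update_self] at h1
    simpa using (h s c N hs hc h0).seq h1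

theorem var (i : ι) : Comp (fun _ x => x i) := by
  refine ⟨⟨.X, fun _ _ _ _ hx => by simpa using hx i⟩, fun loc v hv => ?_⟩
  have hv' := hv i
  -- Copying a unary counter destroys it: the argument goes to the scratch counter `v + 1`, and is
  -- then moved back one unit at a time while `v` is incremented.
  refine ⟨seq (transfer (loc i) (v + 1)) (seq (loop (v + 1 + 2) Option.isSome
    (seq (move (v + 1 + 2) (loc i + 2)) (push (v + 2) none))) skip),
    .X * 2 + 1 + (.X * (1 + 1 + 1 + 1) + 1 + 1 + 1) + 1, fun s c N hs hc h0 => ?_⟩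
  have h1 := runsIn_transfer (r := s) (l := []) (c := c) (i := loc i) (j := v + 1) (by omega)
  rw [h0 (v + 1) (by omega), Nat.zero_add] at h1
  set m := c (loc i) with hm
  have h2 := Runs.loop_family (k := v + 1 + 2) (c := Option.isSome)
    (p := seq (move (v + 1 + 2) (loc i + 2)) (push (v + 2) none)) (T := 1 + 1 + 1)
    (n := m) (fun j => tape s [] (update (update (update c (loc i) j) (v + 1) (m - j)) v j))
    (fun j hj => by rw [isSome_head?_tape, update_of_ne (by omega), update_self]; omega)
    (not_isSome_head?_tape (by simp))
    (fun j hj => by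
      have a := runsIn_moveCounter (r := s) (l := []) (i := v + 1) (j := loc i) (m := m - (j + 1))
        (c := update (update (update c (loc i) j) (v + 1) (m - j)) v j) (by omega)
        (by rw [update_of_ne (by omega), update_self]; omega)
      refine (a.seq (runsIn_inc v)).imp fun t ht => ⟨ht.1, ?_⟩
      convert ht.2 using 2
      funext k
      grind [Function.update_apply])
  have e1 : update (update (update c (loc i) 0) (v + 1) (m - 0)) v 0 =
      update (update c (loc i) 0) (v + 1) m := by
    funext k
    have := h0 v le_rfl
    grind [Function.update_apply]
  have e2 : update (update (update c (loc i) m) (v + 1) (m - m)) v m = update c v m := by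
    funext k
    have := h0 (v + 1) (by omega)
    grind [Function.update_apply]
  rw [e1, e2] at h2
  refine (h1.seq (RunsIn.seq h2 (Runs.skip _).runsIn)).mono ?_
  have : m ≤ N := hc _
  simp
  omega

theorem add (hf : Comp f) (hg : Comp g) : Comp (fun s x => f s x + g s x) := by
  obtain ⟨⟨B, hB⟩, hf⟩ := hf
  obtain ⟨⟨C, hC⟩, hg⟩ := hg
  refine ⟨⟨B + C, fun s x N hs hx => ?_⟩, fun loc v hv => ?_⟩
  · simpa using Nat.add_le_add (hB s x N hs hx) (hC s x N hs hx)
  · obtain ⟨p, T, hp⟩ := hf loc v hv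
    obtain ⟨q, U, hq⟩ := hg loc (v + 1) fun i => (hv i).trans (by omega)
    refine ⟨seq p (seq q (transfer (v + 1) v)), T + (U.comp (.X + B) + (C * 2 + 1) + 1) + 1,
      fun s c N hs hc h0 => ?_⟩
    set x : ι → ℕ := fun i => c (loc i) with hx
    have hb := hB s x N hs fun i => hc _
    have hb' := hC s x N hs fun i => hc _
    -- The second program runs with the value of `f` in counter `v`, so its time bound is taken at
    -- `N + B.eval N`. This is the source of the composition with `.X + B`.
    have h2 := hq s (update c v (f s x)) (N + B.eval N) (by omega)
      (fun i => by have := hc i; rw [update_apply]; split_ifs <;> omega)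
      (fun i hi => by rw [update_of_ne (by omega)]; exact h0 i (by omega))
    rw [show (fun i => update c v (f s x) (loc i)) = x from
      funext fun i => update_of_ne (hv i).ne _ _] at h2
    have h3 := runsIn_transfer (r := s) (l := []) (i := v + 1) (j := v)
      (c := update (update c v (f s x)) (v + 1) (g s x)) (by omega)
    have e : update (update (update (update c v (f s x)) (v + 1) (g s x)) (v + 1) 0) v
        (update (update c v (f s x)) (v + 1) (g s x) v +
          update (update c v (f s x)) (v + 1) (g s x) (v + 1)) =
        update c v (f s x + g s x) := by
      funext k
      have := h0 (v + 1) (by omega)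
      simp only [update_apply]
      split_ifs <;> first | omega | (subst k; omega)
    rw [e, update_self] at h3
    refine ((hp s c N hs hc h0).seq (h2.seq h3)).mono ?_
    simp
    omega

/-- Popping an empty stack leaves it empty, which is truncated subtraction. -/
theorem sub (hf : Comp f) (hg : Comp g) : Comp (fun s x => f s x - g s x) := by
  obtain ⟨⟨B, hB⟩, hf⟩ := hf
  obtain ⟨⟨C, hC⟩, hg⟩ := hg
  refine ⟨⟨B, fun s x N hs hx => (Nat.sub_le _ _).trans (hB s x N hs hx)⟩, fun loc v hv => ?_⟩
  obtain ⟨p, T, hp⟩ := hf loc v hv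
  obtain ⟨q, U, hq⟩ := hg loc (v + 1) fun i => (hv i).trans (by omega)
  refine ⟨seq p (seq q (loop (v + 1 + 2) Option.isSome (seq (pop (v + 1 + 2)) (pop (v + 2))))),
    T + (U.comp (.X + B) + (C * (1 + 1 + 1 + 1) + 1) + 1) + 1, fun s c N hs hc h0 => ?_⟩
  set x : ι → ℕ := fun i => c (loc i) with hx
  have hb := hB s x N hs fun i => hc _
  have hb' := hC s x N hs fun i => hc _
  have h2 := hq s (update c v (f s x)) (N + B.eval N) (by omega)
    (fun i => by have := hc i; rw [update_apply]; split_ifs <;> omega)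
    (fun i hi => by rw [update_of_ne (by omega)]; exact h0 i (by omega))
  rw [show (fun i => update c v (f s x) (loc i)) = x from
    funext fun i => update_of_ne (hv i).ne _ _] at h2
  have h3 := Runs.loop_family (k := v + 1 + 2) (c := Option.isSome)
    (p := seq (pop (v + 1 + 2)) (pop (v + 2))) (T := 1 + 1 + 1) (n := g s x)
    (fun j => tape s [] (update (update c v (f s x - j)) (v + 1) (g s x - j)))
    (fun j hj => by rw [isSome_head?_tape, update_self]; omega)
    (not_isSome_head?_tape (by simp))
    (fun j hj => by
      have a := runsIn_dec (r := s) (l := [])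
        (c := update (update c v (f s x - j)) (v + 1) (g s x - j)) (v + 1)
      refine (a.seq (runsIn_dec v)).imp fun t ht => ⟨ht.1, ?_⟩
      convert ht.2 using 2
      funext k
      simp only [update_apply]
      split_ifs <;> omega)
  have e : update (update c v (f s x - g s x)) (v + 1) (g s x - g s x) =
      update c v (f s x - g s x) := by
    funext k
    have := h0 (v + 1) (by omega)
    simp only [update_apply]
    split_ifs <;> first | omega | (subst k; omega)
  rw [e] at h3
  refine ((hp s c N hs hc h0).seq (h2.seq (T := _) h3)).mono ?_
  simp
  omega

/-- The source of all bounded iteration. Counter `v` holds the number of rounds left, `v + 1` the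
index, `v + 2` the partial sum, and `v + 3` receives the value of `g`. -/
theorem sum {g : List Sym → (Option ι → ℕ) → ℕ} (hf : Comp f) (hg : Comp g) :
    Comp (fun s x => ∑ j ∈ Finset.range (f s x), g s fun o => o.elim j x) := by
  obtain ⟨⟨B, hB⟩, hf⟩ := hf
  obtain ⟨⟨C, hC⟩, hg⟩ := hg
  have hsum : ∀ s (x : ι → ℕ) N, s.length ≤ N → (∀ i, x i ≤ N) → ∀ m ≤ f s x,
      ∑ j ∈ Finset.range m, (g s fun o => o.elim j x) ≤
        B.eval N * C.eval (N + B.eval N) := by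
    intro s x N hs hx m hm
    have hb := hB s x N hs hx
    calc _ ≤ m * C.eval (N + B.eval N) := by
          refine (Finset.sum_le_card_nsmul _ _ (C.eval (N + B.eval N)) fun j hj => ?_).trans
            (by simp)
          have hj' := Finset.mem_range.1 hj
          refine hC s _ _ (by omega) fun o => ?_
          cases o with
          | none => simp only [Option.elim]; omega
          | some i => have := hx i; simp only [Option.elim]; omega
      _ ≤ _ := Nat.mul_le_mul_right _ (hm.trans hb)
  refine ⟨⟨B * C.comp (.X + B), fun s x N hs hx => ?_⟩, fun loc v hv => ?_⟩
  · simpa using hsum s x N hs hx _ le_rfl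
  obtain ⟨p, T, hp⟩ := hf loc v hv
  obtain ⟨q, U, hq⟩ := hg (fun o => o.elim (v + 1) loc) (v + 3) (fun o => by
    cases o with
    | none => simp only [Option.elim]; omega
    | some i => have := hv i; simp only [Option.elim]; omega)
  let body : Polynomial ℕ := U.comp (.X + B + B * C.comp (.X + B)) +
    (C.comp (.X + B) * 2 + 1 + (1 + 1 + 1) + 1) + 1
  refine ⟨seq p (seq (loop (v + 2) Option.isSome
    (seq q (seq (transfer (v + 3) (v + 2)) (seq (pop (v + 2)) (push (v + 1 + 2) none)))))
    (seq (clear (v + 1)) (transfer (v + 2) v))),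
    T + (B * (body + 1) + 1 + (B * 2 + 1 + (B * C.comp (.X + B) * 2 + 1) + 1) + 1) + 1,
    fun s c N hs hc h0 => ?_⟩
  set x : ι → ℕ := fun i => c (loc i) with hx
  set A := f s x with hA
  let σ : ℕ → ℕ := fun m => ∑ j ∈ Finset.range m, g s fun o => o.elim j x
  have hσ : ∀ m ≤ A, σ m ≤ B.eval N * C.eval (N + B.eval N) :=
    hsum s x N hs fun i => hc _
  have hb : A ≤ B.eval N := hB s x N hs fun i => hc _
  let S : ℕ → ℕ → ℕ := fun j => update (update (update c v (A - j)) (v + 1) j) (v + 2) (σ j)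
  have hbody : ∀ j < A, RunsIn
      (seq q (seq (transfer (v + 3) (v + 2)) (seq (pop (v + 2)) (push (v + 1 + 2) none))))
      (tape s [] (S j)) (tape s [] (S (j + 1))) (body.eval N) := by
    intro j hj
    have hσj := hσ j hj.le
    -- The new argument bounds original counters, round counts and partial sums alike, so each round
    -- has the same polynomial time bound.
    have h1 := hq s (S j) (N + B.eval N + B.eval N * C.eval (N + B.eval N)) (by omega)
      (fun i => by
        have := hc i
        simp only [S, update_apply]
        split_ifs <;> omega)
      (fun i hi => by
        have := h0 i (by omega)
        simp only [S, update_apply]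
        split_ifs <;> omega)
    have e : (fun o : Option ι => S j (o.elim (v + 1) loc)) = fun o => o.elim j x := by
      funext o
      cases o with
      | none => simp [S]
      | some i =>
        have := hv i
        simp only [S, update_apply, Option.elim, hx]
        split_ifs <;> first | rfl | omega
    rw [e] at h1
    set y := g s fun o => o.elim j x with hy
    have hy' : y ≤ C.eval (N + B.eval N) := by
      refine hC s _ _ (by omega) fun o => ?_
      cases o with
      | none => simp only [Option.elim]; omega
      | some i => have : x i ≤ N := hc _; simp only [Option.elim]; omega
    have h2 := runsIn_transfer (r := s) (l := []) (i := v + 3) (j := v + 2)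
      (c := update (S j) (v + 3) y) (by omega)
    rw [update_self] at h2
    have h3 := h1.seq (h2.seq ((runsIn_dec v).seq (runsIn_inc (v + 1))))
    have hs1 : σ (j + 1) = σ j + y := Finset.sum_range_succ _ _
    refine (h3.mono ?_).imp fun t ht => ⟨ht.1, ?_⟩
    · simp [body]
      omega
    · convert ht.2 using 2
      funext k
      have := h0 (v + 3) (by omega)
      simp only [S, update_apply]
      split_ifs <;> first | omega | (subst k; omega)
  have h2 := Runs.loop_family (k := v + 2) (c := Option.isSome) (T := body.eval N) (n := A)
    (fun j => tape s [] (S j))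
    (fun j hj => by
      simp only [isSome_head?_tape, S]
      rw [update_of_ne (by omega), update_of_ne (by omega), update_self]
      omega)
    (not_isSome_head?_tape (by simp [S])) hbody
  have e0 : S 0 = update c v A := by
    funext k
    have := h0 (v + 1) (by omega)
    have := h0 (v + 2) (by omega)
    have : σ 0 = 0 := Finset.sum_range_zero _
    simp only [S, update_apply]
    split_ifs <;> first | omega | (subst k; omega)
  rw [e0] at h2
  have h3 := runsIn_clear (r := s) (l := []) (c := S A) (v + 1)
  have h4 := runsIn_transfer (r := s) (l := []) (i := v + 2) (j := v)
    (c := update (S A) (v + 1) 0) (by omega)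
  have e1 : S A (v + 1) = A := by simp [S]
  have e2 : update (S A) (v + 1) 0 (v + 2) = σ A := by simp [S]
  have e3 : update (update (update (S A) (v + 1) 0) (v + 2) 0) v
      (update (S A) (v + 1) 0 v + σ A) = update c v (σ A) := by
    funext k
    have := h0 (v + 1) (by omega)
    have := h0 (v + 2) (by omega)
    simp only [S, update_apply]
    split_ifs <;> first | omega | (subst k; omega)
  rw [e1] at h3
  rw [e2, e3] at h4
  refine ((hp s c N hs hc h0).seq (RunsIn.seq h2 (h3.seq h4))).mono ?_
  have h5 := Nat.mul_le_mul_right (body.eval N + 1) hb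
  have h6 := hσ A le_rfl
  simp only [Polynomial.eval_add, Polynomial.eval_mul, Polynomial.eval_comp, Polynomial.eval_one,
    Polynomial.eval_X, Polynomial.eval_ofNat]
  omega

theorem length : Comp (fun s (_ : ι → ℕ) => s.length) := by
  refine ⟨⟨.X, fun s x N hs hx => by simpa using hs⟩, fun loc v hv => ?_⟩
  refine ⟨seq (loop 0 Option.isSome (seq (move 0 1) (push (v + 2) none))) rewind,
    .X * (1 + 1 + 1 + 1) + 1 + (.X * 2 + 1) + 1, fun s c N hs hc h0 => ?_⟩
  have h1 := Runs.loop_family (k := 0) (c := Option.isSome)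
    (p := seq (move 0 1) (push (v + 2) none)) (T := 1 + 1 + 1) (n := s.length)
    (fun j => tape (s.drop j) (s.take j).reverse (update c v j))
    (fun j hj => by simp [tape, hj])
    (by simp [tape])
    (fun j hj => by
      have a := runsIn_right (r := s.drop (j + 1)) (l := (s.take j).reverse)
        (c := update c v j) s[j]
      rw [List.getElem_cons_drop] at a
      have b := a.seq (runsIn_inc v)
      rwa [update_idem, update_self, ← List.reverse_concat,
        List.take_append_getElem] at b)
  have h2 := runsIn_rewind (r := s.drop s.length) (l := (s.take s.length).reverse)
    (c := update c v s.length)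
  simp only [List.take_length, List.drop_length, List.reverse_reverse, List.append_nil,
    List.length_reverse, List.drop_zero, List.take_zero, List.reverse_nil] at h1 h2
  rw [show update c v 0 = c by rw [← h0 v le_rfl, update_eq_self]] at h1
  refine (RunsIn.seq h1 h2).mono ?_
  simp
  omega

/-- The head moves right as many cells as the position says. Beyond the end, `move` does nothing and
the top of the stack is `none`, in accordance with `s[i]?`; the tape is rewound afterwards. -/
theorem read (a : Sym) (hf : Comp f) :
    Comp (fun s x => if s[f s x]? = some a then 1 else 0) := by
  obtain ⟨⟨B, hB⟩, hf⟩ := hf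
  refine ⟨⟨1, fun s x N hs hx => ?_⟩, fun loc v hv => ?_⟩
  · rw [Polynomial.eval_one]
    dsimp only
    split_ifs <;> omega
  obtain ⟨p, T, hp⟩ := hf loc v hv
  refine ⟨seq p (seq (loop (v + 2) Option.isSome (seq (pop (v + 2)) (move 0 1)))
    (seq (ite 0 (fun b => b == some a) (push (v + 2) none) skip) rewind)),
    T + (B * (1 + 1 + 1 + 1) + 1 + (1 + 1 + (.X * 2 + 1) + 1) + 1) + 1,
    fun s c N hs hc h0 => ?_⟩
  set x : ι → ℕ := fun i => c (loc i) with hx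
  have hb := hB s x N hs fun i => hc _
  set m := f s x with hm
  have h1 := Runs.loop_family (k := v + 2) (c := Option.isSome)
    (p := seq (pop (v + 2)) (move 0 1)) (T := 1 + 1 + 1) (n := m)
    (fun j => tape (s.drop j) (s.take j).reverse (update c v (m - j)))
    (fun j hj => by rw [isSome_head?_tape, update_self]; omega)
    (not_isSome_head?_tape (by simp))
    (fun j hj => by
      have b := runsIn_dec (r := s.drop j) (l := (s.take j).reverse)
        (c := update c v (m - j)) v
      rw [update_idem, update_self, Nat.sub_sub] at b
      refine b.seq ?_
      by_cases hj' : j < s.length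
      · have a := runsIn_right (r := s.drop (j + 1)) (l := (s.take j).reverse)
          (c := update c v (m - (j + 1))) s[j]
        rwa [List.getElem_cons_drop, ← List.reverse_concat,
          List.take_append_getElem] at a
      · rw [List.drop_eq_nil_of_le (by omega), List.drop_eq_nil_of_le (by omega),
          List.take_of_length_le (by omega), List.take_of_length_le (by omega)]
        exact runsIn_right_nil)
  have e0 : update c v (m - m) = c := by
    rw [Nat.sub_self, ← h0 v le_rfl, update_eq_self]
  simp only [e0, List.drop_zero, List.take_zero, List.reverse_nil, Nat.sub_zero] at h1
  have h2 : RunsIn (ite 0 (fun b => b == some a) (push (v + 2) none) skip)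
      (tape (s.drop m) (s.take m).reverse c)
      (tape (s.drop m) (s.take m).reverse (update c v (if s[m]? = some a then 1 else 0)))
      (1 + 1) := by
    have e : (tape (s.drop m) (s.take m).reverse c 0).head? = s[m]? := by
      simp [tape, List.head?_drop]
    by_cases h : s[m]? = some a
    · rw [if_pos h]
      obtain ⟨t, ht, hr⟩ := runsIn_inc (r := s.drop m) (l := (s.take m).reverse) (c := c) v
      rw [h0 v le_rfl] at hr
      exact ⟨t + 1, by omega, .ite_true (by simp [e, h]) hr⟩
    · rw [if_neg h, show update c v 0 = c by rw [← h0 v le_rfl, update_eq_self]]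
      exact ⟨1 + 1, le_rfl, .ite_false (by simp [e, h]) (.skip _)⟩
  have h3 := runsIn_rewind (r := s.drop m) (l := (s.take m).reverse)
    (c := update c v (if s[m]? = some a then 1 else 0))
  rw [List.reverse_reverse, List.take_append_drop] at h3
  refine ((hp s c N hs hc h0).seq (RunsIn.seq h1 (h2.seq h3))).mono ?_
  simp
  omega

end Comp

end HiddenVariable

namespace HiddenVariable

/-! ### Predicates decided in polynomial time -/

open Function StackProg

variable {ι : Type}

namespace Comp

variable {f g : List Sym → (ι → ℕ) → ℕ}

/-- A product is a bounded sum of a constant term. -/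
theorem mul (hf : Comp f) (hg : Comp g) : Comp (fun s x => f s x * g s x) := by
  have := hf.sum (hg.reindex (some : ι → Option ι))
  simpa using this

theorem pow (hf : Comp f) (n : ℕ) : Comp (fun s x => f s x ^ n) := by
  induction n with
  | zero => simpa using const 1
  | succ n ih => simpa only [pow_succ] using ih.mul hf

end Comp

open Classical in
/-- A predicate is decidable in polynomial time if its indicator function is feasible. -/
def Dec (P : List Sym → (ι → ℕ) → Prop) : Prop :=
  Comp fun s x => if P s x then 1 else 0

namespace Dec

variable {P Q : List Sym → (ι → ℕ) → Prop} {f g : List Sym → (ι → ℕ) → ℕ}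

theorem of_ind (hf : Comp f) (h : ∀ s x, (P s x → f s x = 1) ∧ (¬ P s x → f s x = 0)) :
    Dec P := by
  classical
  have : f = fun s x => if P s x then 1 else 0 := by
    funext s x
    split_ifs with hp
    exacts [(h s x).1 hp, (h s x).2 hp]
  unfold Dec
  convert hf
  rw [this]

/-- With truncated subtraction, 1 - (1 - f) is the sign of f. -/
theorem of_pos (hf : Comp f) : Dec (fun s x => 0 < f s x) :=
  of_ind ((Comp.const 1).sub ((Comp.const 1).sub hf)) fun s x => by
    constructor <;> intro h <;> omega

theorem congr (hP : Dec P) (h : ∀ s x, P s x ↔ Q s x) : Dec Q := by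
  have : P = Q := by
    funext s x
    exact propext (h s x)
  exact this ▸ hP

theorem not (hP : Dec P) : Dec (fun s x => ¬ P s x) :=
  of_ind ((Comp.const 1).sub hP) fun s x => by
    constructor <;> intro h <;> simp_all

theorem and (hP : Dec P) (hQ : Dec Q) : Dec (fun s x => P s x ∧ Q s x) :=
  of_ind (Comp.mul hP hQ) fun s x => by
    constructor <;> intro h <;> simp_all; tauto

theorem imp (hP : Dec P) (hQ : Dec Q) : Dec (fun s x => P s x → Q s x) :=
  (hP.and hQ.not).not.congr fun s x => by tauto

theorem iff (hP : Dec P) (hQ : Dec Q) : Dec (fun s x => P s x ↔ Q s x) :=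
  ((hP.imp hQ).and (hQ.imp hP)).congr fun s x => by tauto

theorem eq (hf : Comp f) (hg : Comp g) : Dec (fun s x => f s x = g s x) :=
  ((of_pos (hf.sub hg)).not.and (of_pos (hg.sub hf)).not).congr fun s x => by omega

theorem read (a : Sym) (hf : Comp f) : Dec (fun s x => s[f s x]? = some a) :=
  of_ind (hf.read a) fun s x => by
    constructor <;> intro h <;> simp [h]

/-- A bounded sum of indicators is positive exactly if one of them is 1. -/
theorem exists_lt {R : List Sym → (ι → ℕ) → ℕ → Prop} (hf : Comp f)
    (hR : Dec fun s (y : Option ι → ℕ) => R s (fun i => y (some i)) (y none)) :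
    Dec (fun s x => ∃ j, j < f s x ∧ R s x j) :=
  (of_pos (hf.sum hR)).congr fun s x => by
    simp only [Finset.sum_pos_iff, Finset.mem_range]
    refine exists_congr fun j => and_congr_right fun _ => ?_
    simp only [Option.elim]
    split_ifs with h <;> simp [h]

theorem forall_lt {R : List Sym → (ι → ℕ) → ℕ → Prop} (hf : Comp f)
    (hR : Dec fun s (y : Option ι → ℕ) => R s (fun i => y (some i)) (y none)) :
    Dec (fun s x => ∀ j, j < f s x → R s x j) :=
  (exists_lt (R := fun s x j => ¬ R s x j) hf hR.not).not.congr fun s x => by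
    simp

theorem reindex {κ : Type} {P : List Sym → (κ → ℕ) → Prop} (hP : Dec P) (ρ : κ → ι) :
    Dec (fun s (x : ι → ℕ) => P s fun k => x (ρ k)) :=
  Comp.reindex hP ρ

/-- The quantifier over tuples is n nested bounded quantifiers. Each adds a variable to the index
type, so the induction generalizes `ι`; n is fixed, so the time stays polynomial. -/
theorem exists_tuple {n : ℕ} {R : List Sym → (ι → ℕ) → (Fin n → ℕ) → Prop} (hf : Comp f)
    (hR : Dec fun s (y : ι ⊕ Fin n → ℕ) => R s (fun i => y (.inl i)) (fun i => y (.inr i))) :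
    Dec (fun s x => ∃ t : Fin n → ℕ, (∀ i, t i < f s x) ∧ R s x t) := by
  induction n generalizing ι with
  | zero =>
    refine (hR.reindex (Sum.elim id Fin.elim0)).congr fun s x => ?_
    have : ∀ t : Fin 0 → ℕ, t = fun i => x (Sum.elim id Fin.elim0 (.inr i)) :=
      fun t => Subsingleton.elim _ _
    constructor
    · exact fun h => ⟨_, fun i => i.elim0, h⟩
    · rintro ⟨t, -, h⟩
      rw [this t] at h
      exact h
  | succ n ih =>
    have h1 := ih (R := fun s (y : Option ι → ℕ) t =>
      R s (fun i => y (some i)) (Fin.cons (y none) t)) (hf.reindex some)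
      ((hR.reindex (Sum.elim (fun i => Sum.inl (some i))
        (Fin.cons (Sum.inl none) Sum.inr))).congr fun s y => by
          apply Iff.of_eq
          congr 1
          funext i
          cases i using Fin.cases <;> rfl)
    refine (exists_lt (R := fun s x j => ∃ t : Fin n → ℕ, (∀ i, t i < f s x) ∧
      R s x (Fin.cons j t)) hf h1).congr fun s x => ?_
    constructor
    · rintro ⟨j, hj, t, ht, h⟩
      exact ⟨Fin.cons j t, Fin.cases hj ht, h⟩
    · rintro ⟨t, ht, h⟩
      exact ⟨t 0, ht 0, Fin.tail t, fun i => ht i.succ, by rwa [Fin.cons_self_tail]⟩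

theorem forall_tuple {n : ℕ} {R : List Sym → (ι → ℕ) → (Fin n → ℕ) → Prop} (hf : Comp f)
    (hR : Dec fun s (y : ι ⊕ Fin n → ℕ) => R s (fun i => y (.inl i)) (fun i => y (.inr i))) :
    Dec (fun s x => ∀ t : Fin n → ℕ, (∀ i, t i < f s x) → R s x t) :=
  (exists_tuple (R := fun s x j => ¬ R s x j) hf hR.not).not.congr fun s x => by
    simp

theorem forall_fin {n : ℕ} {R : Fin n → List Sym → (ι → ℕ) → Prop} (hR : ∀ i, Dec (R i)) :
    Dec (fun s x => ∀ i, R i s x) := by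
  induction n with
  | zero => exact (eq (Comp.const 0) (Comp.const 0)).congr fun s x => by simp
  | succ n ih =>
    exact ((hR 0).and (ih fun i => hR i.succ)).congr fun s x =>
      (Fin.forall_fin_succ (P := fun i => R i s x)).symm

/-- A predicate that is decidable in polynomial time in the above sense is decided by a Turing
machine in polynomial time. -/
theorem exists_polyTime {P : List Sym → Prop} (hP : Dec fun s (_ : Empty → ℕ) => P s)
    {α : Type} (ea : α → List Sym) (V : α → Bool) (hV : ∀ a, V a = true ↔ P (ea a)) :
    ∃ M : Turing.TM2ComputableInPolyTime ea Computability.encodeBool V,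
      ∀ j, Finite (M.tm.Γ j) := by
  classical
  -- With `v = 0` the value is left in counter 0, that is, on stack 2, where the compiled machine
  -- expects its result.
  obtain ⟨p, T, h⟩ := hP.2 (fun e => e.elim) 0 (fun e => e.elim)
  have clear0 : ∀ (s : List Sym) (c : ℕ → ℕ),
      RunsIn (loop 0 Option.isSome (pop 0)) (tape s [] c) (tape [] [] c) (s.length * 2 + 1) := by
    intro s c
    induction s with
    | nil => exact ⟨1, by simp, .loop_done rfl⟩
    | cons a s ih =>
      obtain ⟨u, hu, hr⟩ := ih
      refine ⟨1 + u + 1, by simp; omega, .loop_step rfl ?_ hr⟩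
      have := Runs.pop 0 (tape (a :: s) [] c)
      rwa [update_tape_zero] at this
  -- The program for `P` preserves its input, which has to be erased before halting.
  refine StackProg.exists_polyTime ea V (.seq p (loop 0 Option.isSome (pop 0)))
    (T + (.X * 2 + 1) + 1) fun a => ?_
  have h1 := (h (ea a) (fun _ => 0) _ le_rfl (fun _ => Nat.zero_le _) fun _ _ => rfl).seq
    (clear0 _ _)
  have e1 : tape (ea a) [] (fun _ => 0) = update (fun _ => []) 0 (ea a) := by
    funext j
    match j with
    | 0 => rfl
    | 1 => rfl
    | j + 2 => rfl
  have e2 : tape [] [] (update (fun _ => 0) 0 (if P (ea a) then 1 else 0)) =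
      update (fun _ : ℕ => ([] : List Sym)) 2 (if V a then [none] else []) := by
    rw [← update_tape_counter, show tape [] [] (fun _ => 0) = fun _ => [] from ?_]
    · by_cases hp : P (ea a)
      · simp [hp, (hV a).2 hp]
      · have : V a = false := by
          rw [← Bool.not_eq_true, hV]
          exact hp
        simp [hp, this]
    · funext j
      match j with
      | 0 => rfl
      | 1 => rfl
      | j + 2 => rfl
  rw [e1, e2] at h1
  exact h1.mono (by simp)

end Dec

end HiddenVariable

namespace HiddenVariable

/-! ### Ranks of tuples -/

/-- The position of a tuple of numbers below `k` in the lexicographic order. -/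
def rank (k : ℕ) : (n : ℕ) → (Fin n → ℕ) → ℕ
  | 0, _ => 0
  | n + 1, t => t 0 * k ^ n + rank k n fun i => t i.succ

/-- Arithmetic ranks are list positions. The length of the list, the range of `rank` and its
surjectivity are all read off from this. -/
theorem map_rank_tuples (k n : ℕ) :
    ((tuples k n).map fun t => rank k n fun i => t i) = List.range (k ^ n) := by
  induction n with
  | zero => rfl
  | succ n ih =>
    have h1 : ∀ a : Fin k, ((tuples k n).map fun t => (Fin.cons a t : Fin (n + 1) → Fin k)).map
        (fun t => rank k (n + 1) fun i => t i) =
          (List.range (k ^ n)).map fun j => (a : ℕ) * k ^ n + j := by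
      intro a
      rw [← ih, List.map_map, List.map_map]
      rfl
    have h2 : ∀ m, (List.range m).flatMap (fun a => (List.range (k ^ n)).map fun j =>
        a * k ^ n + j) = List.range (m * k ^ n) := by
      intro m
      induction m with
      | zero => simp
      | succ m ihm => simp [List.range_succ, ihm, Nat.add_one_mul, List.range_add]
    rw [tuples, List.map_flatMap]
    simp only [h1]
    rw [pow_succ', ← h2 k, ← List.map_coe_finRange_eq_range (n := k), List.flatMap_map]

theorem length_tuples (k n : ℕ) : (tuples k n).length = k ^ n := by
  simpa using congrArg List.length (map_rank_tuples k n)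

theorem mem_tuples {k n : ℕ} (t : Fin n → Fin k) : t ∈ tuples k n := by
  induction n with
  | zero => simp [tuples, Subsingleton.elim t Fin.elim0]
  | succ n ih =>
    rw [tuples, List.mem_flatMap]
    exact ⟨t 0, List.mem_finRange _,
      List.mem_map.2 ⟨Fin.tail t, ih _, Fin.cons_self_tail t⟩⟩

theorem exists_rank_eq {k n i : ℕ} (hi : i < k ^ n) :
    ∃ t : Fin n → Fin k, (rank k n fun i => t i) = i := by
  have : i ∈ (tuples k n).map fun t => rank k n fun i => t i := by
    rw [map_rank_tuples]
    exact List.mem_range.2 hi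
  obtain ⟨t, -, ht⟩ := List.mem_map.1 this
  exact ⟨t, ht⟩

theorem rank_lt {k n : ℕ} (t : Fin n → Fin k) : (rank k n fun i => t i) < k ^ n := by
  rw [← List.mem_range, ← map_rank_tuples]
  exact List.mem_map_of_mem (mem_tuples t)

theorem getElem?_tuples {k n : ℕ} (t : Fin n → Fin k) :
    (tuples k n)[rank k n fun i => t i]? = some t := by
  obtain ⟨i, hi, rfl⟩ := List.getElem_of_mem (mem_tuples t)
  have h := congrArg (fun l => l[i]?) (map_rank_tuples k n)
  rw [length_tuples] at hi
  simp only [List.getElem?_map, List.getElem?_range hi,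
    List.getElem?_eq_getElem ((length_tuples k n).symm ▸ hi), Option.map_some,
    Option.some_inj] at h
  rw [h, List.getElem?_eq_getElem]

theorem getElem?_flatMap {α β : Type} {f : α → List β} {L : ℕ} (hf : ∀ a, (f a).length = L)
    {l : List α} {a : α} {i j : ℕ} (hi : l[i]? = some a) (hj : j < L) :
    (l.flatMap f)[i * L + j]? = (f a)[j]? := by
  induction l generalizing i with
  | nil => simp at hi
  | cons b l ih =>
    rw [List.flatMap_cons]
    cases i with
    | zero =>
      obtain rfl : b = a := by simpa using hi
      rw [Nat.zero_mul, Nat.zero_add, List.getElem?_append_left (by rw [hf]; exact hj)]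
    | succ i =>
      rw [List.getElem?_append_right (by rw [hf, Nat.add_one_mul]; omega), hf,
        show (i + 1) * L + j - L = i * L + j by rw [Nat.add_one_mul]; omega]
      exact ih (by simpa using hi)

theorem length_flatMap {α β : Type} {f : α → List β} {L : ℕ} (hf : ∀ a, (f a).length = L)
    (l : List α) : (l.flatMap f).length = l.length * L := by
  induction l with
  | nil => simp
  | cons a l ih => rw [List.flatMap_cons, List.length_append, hf, ih, List.length_cons,
      Nat.add_one_mul, Nat.add_comm]

/-- The table of a binary relation between `n`-tuples, in lexicographic order. -/
def table {k n : ℕ} (g : (Fin n → Fin k) → (Fin n → Fin k) → Bool) : List Bool :=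
  (tuples k n).flatMap fun x => (tuples k n).map fun y => g x y

theorem length_table {k n : ℕ} (g : (Fin n → Fin k) → (Fin n → Fin k) → Bool) :
    (table g).length = k ^ n * k ^ n := by
  rw [table, length_flatMap (L := k ^ n) (fun a => by rw [List.length_map, length_tuples]),
    length_tuples]

/-- The position of a pair of tuples in a table. -/
def pairRank (k n : ℕ) (x y : Fin n → ℕ) : ℕ := rank k n x * k ^ n + rank k n y

theorem getElem?_table {k n : ℕ} (g : (Fin n → Fin k) → (Fin n → Fin k) → Bool)
    (x y : Fin n → Fin k) :
    (table g)[pairRank k n (fun i => x i) fun i => y i]? = some (g x y) := by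
  rw [table, pairRank, getElem?_flatMap (fun a => by rw [List.length_map, length_tuples])
    (getElem?_tuples x) (rank_lt y), List.getElem?_map, getElem?_tuples]
  rfl

theorem pairRank_lt {k n : ℕ} (x y : Fin n → Fin k) :
    pairRank k n (fun i => x i) (fun i => y i) < k ^ n * k ^ n := by
  have h := getElem?_table (fun _ _ => true) x y
  rw [← length_table fun (_ _ : Fin n → Fin k) => true]
  exact (List.getElem?_eq_some_iff.1 h).1

theorem exists_pairRank_eq {k n j : ℕ} (hj : j < k ^ n * k ^ n) :
    ∃ x y : Fin n → Fin k, pairRank k n (fun i => x i) (fun i => y i) = j := by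
  have hk : 0 < k ^ n := Nat.pos_of_mul_pos_left (by omega : 0 < k ^ n * k ^ n)
  obtain ⟨x, hx⟩ := exists_rank_eq (Nat.div_lt_of_lt_mul hj)
  obtain ⟨y, hy⟩ := exists_rank_eq (Nat.mod_lt j hk)
  exact ⟨x, y, by rw [pairRank, hx, hy, Nat.div_add_mod']⟩

/-- The table of a relation between two pairs of `n`-tuples. -/
def quadTable {k n : ℕ}
    (g : (Fin n → Fin k) → (Fin n → Fin k) → (Fin n → Fin k) → (Fin n → Fin k) → Bool) :
    List Bool :=
  (tuples k n).flatMap fun x => (tuples k n).flatMap fun y => table (g x y)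

/-- The position of two pairs of tuples in a table. -/
def quadRank (k n : ℕ) (x y z t : Fin n → ℕ) : ℕ :=
  rank k n x * (k ^ n * (k ^ n * k ^ n)) + (rank k n y * (k ^ n * k ^ n) + pairRank k n z t)

theorem length_quadTable {k n : ℕ}
    (g : (Fin n → Fin k) → (Fin n → Fin k) → (Fin n → Fin k) → (Fin n → Fin k) → Bool) :
    (quadTable g).length = k ^ n * (k ^ n * (k ^ n * k ^ n)) := by
  rw [quadTable, length_flatMap (fun a => length_flatMap (fun b => length_table _) _),
    length_tuples]

theorem getElem?_quadTable {k n : ℕ}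
    (g : (Fin n → Fin k) → (Fin n → Fin k) → (Fin n → Fin k) → (Fin n → Fin k) → Bool)
    (x y z t : Fin n → Fin k) :
    (quadTable g)[quadRank k n (fun i => x i) (fun i => y i) (fun i => z i) fun i => t i]? =
      some (g x y z t) := by
  have hl : ∀ a, ((tuples k n).flatMap fun y => table (g a y)).length =
      k ^ n * (k ^ n * k ^ n) := fun a => by
    rw [length_flatMap (fun b => length_table _), length_tuples]
  have hi : ((tuples k n).flatMap fun y => table (g x y))[(rank k n fun i => y i) *
      (k ^ n * k ^ n) + pairRank k n (fun i => z i) fun i => t i]? = some (g x y z t) := by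
    rw [getElem?_flatMap (fun b => length_table _) (getElem?_tuples y) (pairRank_lt z t),
      getElem?_table]
  rw [quadTable, quadRank, getElem?_flatMap hl (getElem?_tuples x), hi]
  rw [← hl x]
  exact (List.getElem?_eq_some_iff.1 hi).1

/-! ### The verifier -/

/-- `e` is total and the relation `h`, with pairs of tuples as values of the hidden variable,
realizes it and satisfies `λ`-independence and locality. All tuples have entries below `k`. -/
def Witnesses (k n : ℕ) (e : (Fin n → ℕ) → (Fin n → ℕ) → Prop)
    (h : (Fin n → ℕ) → (Fin n → ℕ) → (Fin n → ℕ) → (Fin n → ℕ) → Prop) : Prop :=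
  (∀ m : Fin n → ℕ, (∀ i, m i < k) → ∃ o : Fin n → ℕ, (∀ i, o i < k) ∧ e m o) ∧
  (∀ m : Fin n → ℕ, (∀ i, m i < k) → ∀ o : Fin n → ℕ, (∀ i, o i < k) →
    (e m o ↔ ∃ l : Fin n → ℕ, (∀ i, l i < k) ∧ ∃ l' : Fin n → ℕ, (∀ i, l' i < k) ∧
      h m o l l')) ∧
  (∀ m : Fin n → ℕ, (∀ i, m i < k) → ∀ m' : Fin n → ℕ, (∀ i, m' i < k) →
    ∀ l : Fin n → ℕ, (∀ i, l i < k) → ∀ l' : Fin n → ℕ, (∀ i, l' i < k) →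
    (∃ o : Fin n → ℕ, (∀ i, o i < k) ∧ ∃ l : Fin n → ℕ, (∀ i, l i < k) ∧
      ∃ l' : Fin n → ℕ, (∀ i, l' i < k) ∧ h m' o l l') →
    (∃ o : Fin n → ℕ, (∀ i, o i < k) ∧ h m o l l') →
    ∃ o : Fin n → ℕ, (∀ i, o i < k) ∧ h m' o l l') ∧
  (∀ m : Fin n → ℕ, (∀ i, m i < k) → ∀ o : Fin n → ℕ, (∀ i, o i < k) →
    ∀ l : Fin n → ℕ, (∀ i, l i < k) → ∀ l' : Fin n → ℕ, (∀ i, l' i < k) →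
    (∃ o : Fin n → ℕ, (∀ i, o i < k) ∧ h m o l l') →
    (∀ j, ∃ m' : Fin n → ℕ, (∀ i, m' i < k) ∧ ∃ o' : Fin n → ℕ, (∀ i, o' i < k) ∧
      m' j = m j ∧ o' j = o j ∧ h m' o' l l') →
    h m o l l')

theorem forall_lt_iff {k n : ℕ} {P : (Fin n → ℕ) → Prop} :
    (∀ t : Fin n → ℕ, (∀ i, t i < k) → P t) ↔ ∀ t : Fin n → Fin k, P fun i => t i :=
  ⟨fun h t => h _ fun i => (t i).2, fun h t ht => h fun i => ⟨t i, ht i⟩⟩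

theorem exists_lt_iff {k n : ℕ} {P : (Fin n → ℕ) → Prop} :
    (∃ t : Fin n → ℕ, (∀ i, t i < k) ∧ P t) ↔ ∃ t : Fin n → Fin k, P fun i => t i :=
  ⟨fun ⟨t, ht, h⟩ => ⟨fun i => ⟨t i, ht i⟩, h⟩, fun ⟨_, h⟩ => ⟨_, fun _ => Fin.isLt _, h⟩⟩

theorem witnesses_iff {k n : ℕ} {e : (Fin n → ℕ) → (Fin n → ℕ) → Prop}
    {h : (Fin n → ℕ) → (Fin n → ℕ) → (Fin n → ℕ) → (Fin n → ℕ) → Prop}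
    (e' : EmpiricalModel (fun _ : Fin n => Fin k) (fun _ : Fin n => Fin k))
    (h' : HVModel (fun _ : Fin n => Fin k) (fun _ : Fin n => Fin k)
      ((Fin n → Fin k) × (Fin n → Fin k)))
    (he : ∀ m o, e' m o ↔ e (fun i => m i) fun i => o i)
    (hh : ∀ m o l, h' m o l ↔ h (fun i => m i) (fun i => o i) (fun i => l.1 i) fun i => l.2 i) :
    Witnesses k n e h ↔
      e'.Total ∧ h'.Realizes e' ∧ h'.LambdaIndependent ∧ h'.Local := by
  simp only [Witnesses, forall_lt_iff, exists_lt_iff, EmpiricalModel.Total, HVModel.Realizes,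
    HVModel.LambdaIndependent, HVModel.Local, he, hh, Prod.forall, Prod.exists, Fin.ext_iff]

/-- The condition that the verifier checks: the string is `1ᵏ0` followed by the table of a
relation, the separator, and the table of a hidden-variable model for this relation. -/
def Accepts (n : ℕ) (s : List Sym) : Prop :=
  ∃ p, p < s.length ∧ s[p]? = some none ∧ ∃ k, k < p ∧ s[k]? = some (some false) ∧
    (∀ j, j < k → s[j]? = some (some true)) ∧ p = k + 1 + k ^ n * k ^ n ∧
    Witnesses k n (fun m o => s[k + 1 + pairRank k n m o]? = some (some true))
      (fun m o l l' => s[p + 1 + quadRank k n m o l l']? = some (some true))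

/-! ### The verifier's condition is decidable in polynomial time -/

section

variable {ι : Type}

theorem Comp.rank {n : ℕ} {k : List Sym → (ι → ℕ) → ℕ} {t : List Sym → (ι → ℕ) → Fin n → ℕ}
    (hk : Comp k) (ht : ∀ i, Comp fun s x => t s x i) :
    Comp (fun s x => rank (k s x) n (t s x)) := by
  induction n with
  | zero => exact .const 0
  | succ n ih => exact ((ht 0).mul (hk.pow n)).add (ih fun i => ht i.succ)

theorem Comp.pairRank {n : ℕ} {k : List Sym → (ι → ℕ) → ℕ}
    {t u : List Sym → (ι → ℕ) → Fin n → ℕ} (hk : Comp k) (ht : ∀ i, Comp fun s x => t s x i)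
    (hu : ∀ i, Comp fun s x => u s x i) :
    Comp (fun s x => pairRank (k s x) n (t s x) (u s x)) :=
  ((hk.rank ht).mul (hk.pow n)).add (hk.rank hu)

theorem Comp.quadRank {n : ℕ} {k : List Sym → (ι → ℕ) → ℕ}
    {t u v w : List Sym → (ι → ℕ) → Fin n → ℕ} (hk : Comp k) (ht : ∀ i, Comp fun s x => t s x i)
    (hu : ∀ i, Comp fun s x => u s x i) (hv : ∀ i, Comp fun s x => v s x i)
    (hw : ∀ i, Comp fun s x => w s x i) :
    Comp (fun s x => quadRank (k s x) n (t s x) (u s x) (v s x) (w s x)) :=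
  ((hk.rank ht).mul ((hk.pow n).mul ((hk.pow n).mul (hk.pow n)))).add
    (((hk.rank hu).mul ((hk.pow n).mul (hk.pow n))).add (hk.pairRank hv hw))

theorem dec_witnesses (n : ℕ) (k p : ι) :
    Dec fun s (x : ι → ℕ) =>
      Witnesses (x k) n
        (fun m o => s[x k + 1 + pairRank (x k) n m o]? = some (some true))
        (fun m o l l' => s[x p + 1 + quadRank (x k) n m o l l']? = some (some true)) := by
  simp only [Witnesses]
  refine Dec.and ?_ (Dec.and ?_ (Dec.and ?_ ?_)) <;>
  -- The condition consists of bounded quantifiers, connectives, equations and look-ups, so the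
  -- closure rules apply along its syntax.
  repeat' first
    | exact Comp.var _
    | intro _
    | apply Dec.forall_tuple
    | apply Dec.exists_tuple
    | apply Dec.forall_fin
    | apply Dec.and
    | apply Dec.iff
    | apply Dec.imp
    | apply Dec.eq
    | apply Dec.read
    | exact Comp.const _
    | apply Comp.pairRank
    | apply Comp.quadRank
    | apply Comp.add

theorem dec_accepts (n : ℕ) : Dec fun s (_ : ι → ℕ) => Accepts n s := by
  refine Dec.exists_lt Comp.length (Dec.and (Dec.read _ (Comp.var _)) (Dec.exists_lt (Comp.var _)
    (Dec.and (Dec.read _ (Comp.var _)) (Dec.and (Dec.forall_lt (Comp.var _)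
      (Dec.read _ (Comp.var _))) (Dec.and (Dec.eq (Comp.var _) ?_) ?_)))))
  · exact ((Comp.var _).add (.const 1)).add (((Comp.var _).pow n).mul ((Comp.var _).pow n))
  -- The innermost bound variable `none` is `k`; `some none` is the position `p` of the separator,
  -- bound outside it.
  · exact dec_witnesses n none (some none)

end

end HiddenVariable

/-! ### Acceptance in terms of the input and the certificate -/

namespace HiddenVariable

theorem encodePair_getElem?_left {x w : List Bool} {i : ℕ} (hi : i < x.length) :
    (encodePair (x, w))[i]? = x[i]?.map some := by
  rw [encodePair, List.getElem?_append_left (by simpa using hi), List.getElem?_map]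

theorem encodePair_getElem?_right {x w : List Bool} (i : ℕ) :
    (encodePair (x, w))[x.length + 1 + i]? = w[i]?.map some := by
  rw [encodePair, List.getElem?_append_right (by simp; omega), List.length_map,
    show x.length + 1 + i - x.length = i + 1 by omega, List.getElem?_cons_succ,
    List.getElem?_map]

/-- The separator occurs only once, so it determines where the certificate begins. -/
theorem encodePair_getElem?_eq_none {x w : List Bool} {i : ℕ} :
    (encodePair (x, w))[i]? = some none ↔ i = x.length := by
  constructor
  · intro h
    rcases lt_trichotomy i x.length with hi | hi | hi
    · rw [encodePair_getElem?_left hi] at h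
      simp at h
    · exact hi
    · obtain ⟨j, rfl⟩ := Nat.exists_eq_add_of_lt hi
      rw [show x.length + j + 1 = x.length + 1 + j by omega, encodePair_getElem?_right] at h
      simp at h
  · rintro rfl
    simp [encodePair]

theorem getElem?_map_some {x : List Bool} {i : ℕ} {b : Bool} :
    x[i]?.map some = some (some b) ↔ x[i]? = some b := by
  simp

/-- No length is demanded of `w`: positions beyond its end count as false, so every string describes
some relation `h`. -/
theorem accepts_encodePair {n : ℕ} {x w : List Bool} :
    Accepts n (encodePair (x, w)) ↔
      ∃ (k : ℕ) (e : EmpiricalModel (fun _ : Fin n => Fin k) (fun _ : Fin n => Fin k))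
        (h : HVModel (fun _ : Fin n => Fin k) (fun _ : Fin n => Fin k)
          ((Fin n → Fin k) × (Fin n → Fin k))),
        x[k]? = some false ∧ (∀ j < k, x[j]? = some true) ∧
        x.length = k + 1 + k ^ n * k ^ n ∧
        (∀ m o, e m o ↔ x[k + 1 + pairRank k n (fun i => m i) fun i => o i]? = some true) ∧
        (∀ m o l, h m o l ↔ w[quadRank k n (fun i => m i) (fun i => o i) (fun i => l.1 i)
          fun i => l.2 i]? = some true) ∧
        e.Total ∧ h.Realizes e ∧ h.LambdaIndependent ∧ h.Local := by
  have hl : ∀ k, x.length = k + 1 + k ^ n * k ^ n → ∀ m o : Fin n → Fin k,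
      (encodePair (x, w))[k + 1 + pairRank k n (fun i => m i) fun i => o i]? = some (some true) ↔
        x[k + 1 + pairRank k n (fun i => m i) fun i => o i]? = some true := by
    intro k hk m o
    have := pairRank_lt m o
    rw [encodePair_getElem?_left (by omega), getElem?_map_some]
  constructor
  · rintro ⟨p, -, hp, k, hk, h1, h2, h3, h4⟩
    obtain rfl := encodePair_getElem?_eq_none.1 hp
    rw [encodePair_getElem?_left hk, getElem?_map_some] at h1
    refine ⟨k, _, _, h1, fun j hj => ?_, h3, fun m o => Iff.rfl, fun m o l => Iff.rfl,
      (witnesses_iff _ _ (fun m o => (hl k h3 m o).symm) fun m o l => ?_).1 h4⟩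
    · have := h2 j hj
      rwa [encodePair_getElem?_left (hj.trans hk), getElem?_map_some] at this
    · rw [encodePair_getElem?_right, getElem?_map_some]
  · rintro ⟨k, e, h, h1, h2, h3, he, hh, h4⟩
    have hk : k < x.length := by omega
    refine ⟨x.length, by simp [encodePair], encodePair_getElem?_eq_none.2 rfl, k, hk, ?_,
      fun j hj => ?_, h3, (witnesses_iff e h (fun m o => ?_) fun m o l => ?_).2 h4⟩
    · rw [encodePair_getElem?_left hk, getElem?_map_some, h1]
    · rw [encodePair_getElem?_left (hj.trans hk), getElem?_map_some, h2 j hj]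
    · rw [he, hl k h3]
    · rw [hh, encodePair_getElem?_right, getElem?_map_some]

/-! ### The bits of an encoded structure -/

section Encode

open Classical

variable {n k : ℕ} (A : FinModel n) (σ : Fin k ≃ A.U)

theorem encode_eq : A.encode σ = List.replicate k true ++ false ::
    table fun x y : Fin n → Fin k => decide (A.e (fun i => σ (x i)) fun i => σ (y i)) := rfl

theorem length_encode : (A.encode σ).length = k + 1 + k ^ n * k ^ n := by
  rw [encode_eq, List.length_append, List.length_cons, length_table, List.length_replicate]
  omega

theorem encode_getElem?_lt {j : ℕ} (hj : j < k) : (A.encode σ)[j]? = some true := by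
  rw [encode_eq, List.getElem?_append_left (by simpa using hj)]
  simp [hj]

theorem encode_getElem?_self : (A.encode σ)[k]? = some false := by
  simp [encode_eq]

theorem encode_getElem?_pairRank (x y : Fin n → Fin k) :
    (A.encode σ)[k + 1 + pairRank k n (fun i => x i) fun i => y i]? =
      some (decide (A.e (fun i => σ (x i)) fun i => σ (y i))) := by
  rw [encode_eq, List.getElem?_append_right (by rw [List.length_replicate]; omega),
    List.length_replicate, Nat.add_assoc, Nat.add_sub_cancel_left, Nat.add_comm,
    List.getElem?_cons_succ, getElem?_table]

-- Unique decoding: the first `false` fixes `k`, and each later position is the rank of a pair of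
-- tuples.
variable {A σ} in
theorem encode_eq_iff {x : List Bool} : A.encode σ = x ↔
    x[k]? = some false ∧ (∀ j < k, x[j]? = some true) ∧ x.length = k + 1 + k ^ n * k ^ n ∧
      ∀ m o : Fin n → Fin k, A.e (fun i => σ (m i)) (fun i => σ (o i)) ↔
        x[k + 1 + pairRank k n (fun i => m i) fun i => o i]? = some true := by
  constructor
  · rintro rfl
    refine ⟨encode_getElem?_self A σ, fun j hj => encode_getElem?_lt A σ hj, length_encode A σ,
      fun m o => ?_⟩
    rw [encode_getElem?_pairRank, Option.some_inj, decide_eq_true_iff]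
  · rintro ⟨h1, h2, h3, h4⟩
    refine List.ext_getElem? fun i => ?_
    rcases lt_trichotomy i k with hi | rfl | hi
    · rw [h2 i hi, encode_getElem?_lt A σ hi]
    · rw [h1, encode_getElem?_self A σ]
    · by_cases hi' : i < k + 1 + k ^ n * k ^ n
      · obtain ⟨j, rfl⟩ := Nat.exists_eq_add_of_lt hi
        obtain ⟨m, o, rfl⟩ := exists_pairRank_eq (k := k) (n := n) (j := j) (by omega)
        rw [Nat.add_right_comm, encode_getElem?_pairRank]
        have hx : k + 1 + pairRank k n (fun i => m i) (fun i => o i) < x.length := by omega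
        have := h4 m o
        rw [List.getElem?_eq_getElem hx] at this ⊢
        rw [Option.some_inj] at this ⊢
        rw [Bool.eq_iff_iff, decide_eq_true_iff, this]
      · rw [List.getElem?_eq_none (by rw [length_encode]; omega),
          List.getElem?_eq_none (by omega)]

end Encode

/-! ### Small hidden variables and certificates -/

/-- If a total model is realized by a local hidden-variable model, then it is realized by one
whose hidden variable takes pairs of joint measurements and joint outcomes as values. -/
theorem EmpiricalModel.LocallyRealizable.exists_pairs {n : ℕ} {M O : Fin n → Type}
    {e : EmpiricalModel M O} (he : e.LocallyRealizable) :
    ∃ h : HVModel M O ((∀ i, M i) × (∀ i, O i)),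
      h.Realizes e ∧ h.LambdaIndependent ∧ h.Local := by
  obtain ⟨Λ, h, hr, hi, hl⟩ := he
  have : ∀ q : {q : (∀ i, M i) × (∀ i, O i) // e q.1 q.2}, ∃ l, h q.1.1 q.1.2 l :=
    fun q => (hr _ _).1 q.2
  choose f hf using this
  -- A pair `q` in `e` stands for its chosen value `f q`. For a pair outside `e` the new relation is
  -- empty, so it satisfies λ-independence and locality vacuously.
  refine ⟨fun m o q => ∃ hq : e q.1 q.2, h m o (f ⟨q, hq⟩), fun m o => ⟨fun hmo => ?_, ?_⟩, ?_, ?_⟩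
  · exact ⟨(m, o), hmo, hf ⟨(m, o), hmo⟩⟩
  · rintro ⟨q, hq, h'⟩
    exact (hr _ _).2 ⟨_, h'⟩
  · rintro m m' l ⟨o', l', hl', h1⟩ ⟨o, hq, h2⟩
    obtain ⟨o'', h3⟩ := hi m m' _ ⟨o', _, h1⟩ ⟨o, h2⟩
    exact ⟨o'', hq, h3⟩
  · rintro m o l ⟨o', hq, h1⟩ h2
    refine ⟨hq, hl _ _ _ ⟨o', h1⟩ fun i => ?_⟩
    obtain ⟨m', o', hm, ho, _, h3⟩ := h2 i
    exact ⟨m', o', hm, ho, h3⟩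

/-- Transport of the properties of models along a bijection of the universe. -/
theorem HV.of_equiv {n : ℕ} {A : FinModel n} (hA : A ∈ HV n) {U : Type} (σ : U ≃ A.U) :
    EmpiricalModel.Total (M := fun _ : Fin n => U) (O := fun _ : Fin n => U)
      (fun m o => A.e (fun i => σ (m i)) fun i => σ (o i)) ∧
    EmpiricalModel.LocallyRealizable (M := fun _ : Fin n => U) (O := fun _ : Fin n => U)
      (fun m o => A.e (fun i => σ (m i)) fun i => σ (o i)) := by
  obtain ⟨ht, Λ, h, hr, hi, hl⟩ := hA
  refine ⟨fun m => ?_, Λ, fun m o l => h (fun i => σ (m i)) (fun i => σ (o i)) l,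
    fun m o => hr _ _, fun m m' l => ?_, fun m o l => ?_⟩
  · obtain ⟨o, ho⟩ := ht fun i => σ (m i)
    exact ⟨fun i => σ.symm (o i), by simpa using ho⟩
  · rintro ⟨o', l', h1⟩ ⟨o, h2⟩
    obtain ⟨o'', h3⟩ := hi _ _ _ ⟨_, _, h1⟩ ⟨_, h2⟩
    exact ⟨fun i => σ.symm (o'' i), by simpa using h3⟩
  · rintro ⟨o', h1⟩ h2
    refine hl _ _ _ ⟨_, h1⟩ fun i => ?_
    obtain ⟨m', o'', hm, ho, h3⟩ := h2 i
    exact ⟨_, _, congrArg σ hm, congrArg σ ho, h3⟩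

theorem mem_languageOf_HV_iff {n : ℕ} {x : List Bool} :
    x ∈ languageOf (HV n) ↔
      ∃ w : List Bool, w.length ≤ x.length ^ 2 ∧ Accepts n (encodePair (x, w)) := by
  classical
  constructor
  · rintro ⟨A, hA, k, σ, hx⟩
    obtain ⟨ht, hlr⟩ := HV.of_equiv hA σ
    obtain ⟨h, hh⟩ := hlr.exists_pairs
    obtain ⟨h1, h2, h3, h4⟩ := encode_eq_iff.1 hx
    refine ⟨quadTable fun m o l l' : Fin n → Fin k => decide (h m o (l, l')), ?_,
      accepts_encodePair.2 ⟨k, _, h, h1, h2, h3, h4, fun m o l => ?_, ht, hh⟩⟩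
    -- The table has (k^n * k^n)^2 bits, and k^n * k^n is at most the length of `x`.
    · rw [length_quadTable, h3, sq, ← Nat.mul_assoc]
      exact Nat.mul_le_mul (Nat.le_add_left _ _) (Nat.le_add_left _ _)
    · rw [getElem?_quadTable, Option.some_inj, decide_eq_true_iff]
  · rintro ⟨w, -, hw⟩
    obtain ⟨k, e, h, h1, h2, h3, he, -, ht, hh⟩ := accepts_encodePair.1 hw
    -- The accepted string is read as a structure on `Fin k` itself, listed in its natural order.
    exact ⟨⟨Fin k, inferInstance, e⟩, ⟨ht, _, h, hh⟩, k, Equiv.refl _,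
      encode_eq_iff.2 ⟨h1, h2, h3, he⟩⟩

end HiddenVariable

theorem mainTheorem11 (n : ℕ) (hn : 0 < n) :
    HiddenVariable.InNP (HiddenVariable.languageOf (HiddenVariable.HV n)) := by
  classical
  obtain ⟨T, hT⟩ := (HiddenVariable.dec_accepts n).exists_polyTime
    HiddenVariable.encodePair
    (fun xw => decide (HiddenVariable.Accepts n (HiddenVariable.encodePair xw)))
    fun xw => decide_eq_true_iff
  refine ⟨.X ^ 2, _, T, hT, fun x =>
    HiddenVariable.mem_languageOf_HV_iff.trans ?_⟩
  simp only [Polynomial.eval_pow, Polynomial.eval_X, decide_eq_true_iff]
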